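/- Let $n\ge 2$. For an $n\times n$ complex matrix $M$ and an integer $r\ge 0$, the $r$-rigidity of $M$ is the smallest $s$ such that $M=A+B$ with $\operatorname{rank}A\le r$ and $B$ having exactly $s$ nonzero entries. Let ${\mathcal R}[n,r,s]\subset \mathrm{Mat}_{n\times n}(\mathbb C)$ be the Zariski closure of the set of matrices of $r$-rigidity at most $s$, and call $M$ maximally $r$-border rigid if $M\notin{\mathcal R}[n,r,(n-r)^2-1]$. Let the Vandermonde variety $\mathrm{Vand}_n\subset \mathrm{Mat}_{n\times n}(\mathbb C)$ be the Zariski closure of the image of the map $$\mathbb C^{n+1}\to \mathrm{Mat}_{n\times n}(\mathbb C),\qquad (y_0,y_1,\dots,y_n)\mapsto \bigl(y_0^{\,n-i}\,y_j^{\,i-1}\bigr)_{1\le i,j\le n}.$$ Then $\mathrm{Vand}_n\not\subset{\mathcal R}[n,1,n^2-2n]$ and $\mathrm{Vand}_n\not\subset{\mathcal R}[n,n-2,3]$. Hence Vandermonde matrices are generically maximally $1$-border rigid and maximally $(n-2)$-border rigid: every matrix in some Zariski-open, Zariski-dense subset of $\mathrm{Vand}_n$ has both properties, and there is a nonzero polynomial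 $P\in\mathbb C[x_1,\dots,x_n]$ such that the Vandermonde matrix $(x_j^{\,i-1})_{1\le i,j\le n}$ has both properties for all $(x_1,\dots,x_n)\in\mathbb C^n$ with $P(x_1,\dots,x_n)\neq0$. -/

import Mathlib

namespace MatrixRigidity

/-- The `r`-rigidity of `M`: the smallest `s` such that `M = A + B` with `A` of rank at most `r`
and `B` having exactly `s` nonzero entries. -/
noncomputable def rigidity {n : ℕ} (r : ℕ) (M : Matrix (Fin n) (Fin n) ℂ) : ℕ :=
  sInf {s : ℕ | ∃ A B : Matrix (Fin n) (Fin n) ℂ,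
    A.rank ≤ r ∧ Set.ncard {p : Fin n × Fin n | B p.1 p.2 ≠ 0} = s ∧ M = A + B}

/-- The value at the matrix `M` of a polynomial in the matrix entries. -/
noncomputable def evalAt {n : ℕ} (M : Matrix (Fin n) (Fin n) ℂ)
    (P : MvPolynomial (Fin n × Fin n) ℂ) : ℂ :=
  MvPolynomial.eval (fun p : Fin n × Fin n => M p.1 p.2) P

/-- The Zariski closure of a set of matrices: the common zero set of all polynomials vanishing
on the set. -/
def zariskiClosure {n : ℕ} (X : Set (Matrix (Fin n) (Fin n) ℂ)) :
    Set (Matrix (Fin n) (Fin n) ℂ) :=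
  {M | ∀ P : MvPolynomial (Fin n × Fin n) ℂ, (∀ A ∈ X, evalAt A P = 0) → evalAt M P = 0}

/-- The set of `n × n` matrices of `r`-rigidity at most `s`. -/
def rigiditySet (n r s : ℕ) : Set (Matrix (Fin n) (Fin n) ℂ) :=
  {M | rigidity r M ≤ s}

/-- The variety of `n × n` matrices of `r`-border rigidity at most `s`. -/
def rigidityVariety (n r s : ℕ) : Set (Matrix (Fin n) (Fin n) ℂ) :=
  zariskiClosure (rigiditySet n r s)

/-- `M` is maximally `r`-border rigid. -/
def IsMaximallyBorderRigid {n : ℕ} (r : ℕ) (M : Matrix (Fin n) (Fin n) ℂ) : Prop :=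
  M ∉ rigidityVariety n r ((n - r) ^ 2 - 1)

/-- The homogenized Vandermonde map: with rows numbered from `0`, the entry in row `i` of the
column with parameter `y_j` is `y_0 ^ (n - 1 - i) * y_j ^ i`. -/
def vandermondeMap (n : ℕ) (y : Fin (n + 1) → ℂ) : Matrix (Fin n) (Fin n) ℂ :=
  Matrix.of fun i j => y 0 ^ (n - 1 - (i : ℕ)) * y j.succ ^ (i : ℕ)

/-- The Vandermonde variety: the closure of the image of the homogenized Vandermonde map. -/
def vandermondeVariety (n : ℕ) : Set (Matrix (Fin n) (Fin n) ℂ) :=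
  zariskiClosure (Set.range (vandermondeMap n))

/-- `p` holds at a general point of `X`: at every point of some Zariski-open subset of `X` that
is Zariski-dense in `X`. The open subset is where the polynomials of `F` do not all vanish. -/
def HoldsGenericallyOn {n : ℕ} (X : Set (Matrix (Fin n) (Fin n) ℂ))
    (p : Matrix (Fin n) (Fin n) ℂ → Prop) : Prop :=
  ∃ F : Set (MvPolynomial (Fin n × Fin n) ℂ),
    X ⊆ zariskiClosure {M | M ∈ X ∧ ∃ Q ∈ F, evalAt M Q ≠ 0} ∧
    ∀ M ∈ X, (∃ Q ∈ F, evalAt M Q ≠ 0) → p M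

end MatrixRigidity

namespace MatrixRigidity
open Matrix

/-! For each of the two ranks it suffices to find one polynomial in the matrix entries that vanishes
on the rigidity set but not identically on Vandermonde matrices. The product of the two polynomials
then yields every assertion; density of its nonvanishing locus holds because the Vandermonde variety
is parametrized by an affine space.

Rank 1 (`exists_pullback_ne_zero_one`): a matrix in the set agrees with a rank-one matrix on a set
`T` of at least `2 * n` cells. Integer weights on `T` with zero row and column sums give a binomial
vanishing on rank-one matrices. On a Vandermonde matrix the exponents of `x_j` in its two monomials
differ by the moment `∑ i, i * w (i, j)`, so a weight with a nonzero moment is needed;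
`exists_moment_ne_zero` finds one by duality.

Rank `n - 2` (`exists_pullback_ne_zero_sub_two`): three changed cells either lie in a row and a
column together, and then an entry of the adjugate vanishes, or lie in distinct rows and columns,
and then two three-cycle products in the adjugate coincide (`cycleForm_adjugate_eq_zero`). For
Vandermonde matrices the adjugate rows are, up to scalars, the coefficients of `∏_{k ≠ j} (X -
x_k)`, and 0/1 specializations show that neither relation holds generically. -/

/-- The pullback of a polynomial in the matrix entries along `x ↦ (x_j ^ i)`. -/
noncomputable def pullback (n : ℕ) :
    MvPolynomial (Fin n × Fin n) ℂ →ₐ[ℂ] MvPolynomial (Fin n) ℂ :=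
  MvPolynomial.bind₁ fun p => MvPolynomial.X p.2 ^ (p.1 : ℕ)

theorem eval_pullback {n : ℕ} (x : Fin n → ℂ) (Q : MvPolynomial (Fin n × Fin n) ℂ) :
    MvPolynomial.eval x (pullback n Q) = evalAt (vandermonde x)ᵀ Q := by
  simp only [pullback, evalAt, MvPolynomial.eval]
  rw [MvPolynomial.eval₂Hom_bind₁]
  simp [MvPolynomial.coe_eval₂Hom, vandermonde_apply]

/-- The pullback of a polynomial in the matrix entries along `vandermondeMap n`. -/
noncomputable def homogeneousPullback (n : ℕ) :
    MvPolynomial (Fin n × Fin n) ℂ →ₐ[ℂ] MvPolynomial (Fin (n + 1)) ℂ :=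
  MvPolynomial.bind₁ fun p =>
    MvPolynomial.X 0 ^ (n - 1 - (p.1 : ℕ)) * MvPolynomial.X p.2.succ ^ (p.1 : ℕ)

theorem eval_homogeneousPullback {n : ℕ} (y : Fin (n + 1) → ℂ)
    (Q : MvPolynomial (Fin n × Fin n) ℂ) :
    MvPolynomial.eval y (homogeneousPullback n Q) = evalAt (vandermondeMap n y) Q := by
  simp only [homogeneousPullback, evalAt, MvPolynomial.eval]
  rw [MvPolynomial.eval₂Hom_bind₁]
  simp [MvPolynomial.coe_eval₂Hom, vandermondeMap]

theorem vandermondeMap_cons_one {n : ℕ} (x : Fin n → ℂ) :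
    vandermondeMap n (Fin.cons 1 x) = (vandermonde x)ᵀ := by
  ext i j
  simp [vandermondeMap, vandermonde_apply]

theorem exists_eval_ne_zero {σ : Type*} {P : MvPolynomial σ ℂ} (hP : P ≠ 0) :
    ∃ x, MvPolynomial.eval x P ≠ 0 := by
  by_contra! h
  exact hP (MvPolynomial.funext fun x => by simpa using h x)

theorem ne_zero_of_eval_ne_zero {σ : Type*} {P : MvPolynomial σ ℂ} {x : σ → ℂ}
    (h : MvPolynomial.eval x P ≠ 0) : P ≠ 0 := by
  rintro rfl
  simp at h

theorem homogeneousPullback_ne_zero {n : ℕ} {Q : MvPolynomial (Fin n × Fin n) ℂ}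
    (hQ : pullback n Q ≠ 0) : homogeneousPullback n Q ≠ 0 := by
  obtain ⟨x, hx⟩ := exists_eval_ne_zero hQ
  apply ne_zero_of_eval_ne_zero (x := Fin.cons 1 x)
  rwa [eval_homogeneousPullback, vandermondeMap_cons_one, ← eval_pullback]

theorem subset_zariskiClosure {n : ℕ} (X : Set (Matrix (Fin n) (Fin n) ℂ)) :
    X ⊆ zariskiClosure X := fun _ hM _ hP => hP _ hM

theorem transpose_vandermonde_mem {n : ℕ} (x : Fin n → ℂ) :
    (vandermonde x)ᵀ ∈ vandermondeVariety n :=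
  subset_zariskiClosure _ ⟨_, vandermondeMap_cons_one x⟩

/-- This is irreducibility: if `P` vanishes wherever `Q` does not, the pullback of `P * Q` is zero
in a polynomial ring, which is a domain. -/
theorem vandermondeVariety_subset_zariskiClosure {n : ℕ} {Q : MvPolynomial (Fin n × Fin n) ℂ}
    (hQ : pullback n Q ≠ 0) :
    vandermondeVariety n ⊆ zariskiClosure {M | M ∈ vandermondeVariety n ∧ evalAt M Q ≠ 0} := by
  intro M hM P hP
  apply hM
  have h : homogeneousPullback n P = 0 := by
    refine (mul_eq_zero.mp ?_).resolve_right (homogeneousPullback_ne_zero hQ)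
    apply MvPolynomial.funext
    intro y
    rw [map_mul, eval_homogeneousPullback, eval_homogeneousPullback, map_zero]
    by_cases hy : evalAt (vandermondeMap n y) Q = 0
    · rw [hy, mul_zero]
    · rw [hP _ ⟨subset_zariskiClosure _ ⟨y, rfl⟩, hy⟩, zero_mul]
  rintro _ ⟨y, rfl⟩
  rw [← eval_homogeneousPullback, h, map_zero]

theorem notMem_rigidityVariety {n r s : ℕ} {Q : MvPolynomial (Fin n × Fin n) ℂ}
    (hQ : ∀ M ∈ rigiditySet n r s, evalAt M Q = 0) {M : Matrix (Fin n) (Fin n) ℂ}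
    (hM : evalAt M Q ≠ 0) : M ∉ rigidityVariety n r s := fun h => hM (h Q hQ)

theorem exists_decomposition {n r s : ℕ} {M : Matrix (Fin n) (Fin n) ℂ}
    (hM : M ∈ rigiditySet n r s) :
    ∃ A B : Matrix (Fin n) (Fin n) ℂ, A.rank ≤ r ∧
      (Finset.univ.filter fun p : Fin n × Fin n => B p.1 p.2 ≠ 0).card ≤ s ∧ M = A + B := by
  have hne : {s : ℕ | ∃ A B : Matrix (Fin n) (Fin n) ℂ, A.rank ≤ r ∧
      Set.ncard {p : Fin n × Fin n | B p.1 p.2 ≠ 0} = s ∧ M = A + B}.Nonempty :=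
    ⟨_, 0, M, by simp, rfl, by simp⟩
  obtain ⟨A, B, hA, hB, h⟩ := Nat.sInf_mem hne
  refine ⟨A, B, hA, ?_, h⟩
  rw [← Set.ncard_coe_finset]
  have h' : rigidity r M ≤ s := hM
  simpa [← hB, rigidity] using hB.trans_le h'

/-! ### Rank one: binomials from weights on a set of cells -/

theorem exists_eq_vecMulVec {K m l : Type*} [Field K] [Fintype m] [Fintype l]
    {A : Matrix m l K} (hA : A.rank ≤ 1) : ∃ (u : m → K) (v : l → K), A = vecMulVec u v := by
  rw [rank_eq_finrank_span_cols, finrank_le_one_iff] at hA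
  obtain ⟨u, hu⟩ := hA
  choose v hv using fun j => hu ⟨A.col j, Submodule.subset_span ⟨j, rfl⟩⟩
  refine ⟨u, v, ?_⟩
  ext i j
  have := congrFun (congrArg Subtype.val (hv j)) i
  simpa [vecMulVec_apply, mul_comm] using this.symm

/-- The linear functionals on `n × n` matrices given by the row sums, the column sums, and the
entries outside `T`. -/
def marginals {n : ℕ} (T : Finset (Fin n × Fin n)) :
    Fin n ⊕ Fin n ⊕ {p // p ∉ T} → ((Fin n × Fin n → ℚ) →ₗ[ℚ] ℚ)
  | .inl i => ∑ j, LinearMap.proj (i, j)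
  | .inr (.inl j) => ∑ i, LinearMap.proj (i, j)
  | .inr (.inr p) => LinearMap.proj p.1

theorem mem_iInf_ker_marginals {n : ℕ} {T : Finset (Fin n × Fin n)} {w : Fin n × Fin n → ℚ} :
    w ∈ ⨅ k, LinearMap.ker (marginals T k) ↔
      (∀ i, ∑ j, w (i, j) = 0) ∧ (∀ j, ∑ i, w (i, j) = 0) ∧ ∀ p ∉ T, w p = 0 := by
  simp [marginals, Submodule.mem_iInf, Sum.forall]

/-- The `2 * n` row and column conditions satisfy one relation, as both families add up to the
total, so they cannot cut a space of dimension at least `2 * n` down to zero. -/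
theorem exists_mem_iInf_ker_marginals_ne_zero {n : ℕ} (hn : 0 < n) {T : Finset (Fin n × Fin n)}
    (hT : 2 * n ≤ T.card) : ∃ w ∈ ⨅ k, LinearMap.ker (marginals T k), w ≠ 0 := by
  by_contra! h
  have hinj : Function.Injective (LinearMap.pi (marginals T)) := by
    rw [← LinearMap.ker_eq_bot, LinearMap.ker_pi, eq_bot_iff]
    exact fun w hw => h w hw
  have hcard : Fintype.card {p // p ∉ T} = n * n - T.card := by
    simp [Fintype.card_subtype_compl]
  have hTn : T.card ≤ n * n := by simpa using T.card_le_univ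
  have hsurj : Function.Surjective (LinearMap.pi (marginals T)) := by
    refine (LinearMap.injective_iff_surjective_of_finrank_eq_finrank
      (le_antisymm (LinearMap.finrank_le_finrank_of_injective hinj) ?_)).mp hinj
    simp only [Module.finrank_fintype_fun_eq_card, Fintype.card_sum, hcard, Fintype.card_prod,
      Fintype.card_fin]
    omega
  -- Row sums 1 and column sums 0 are incompatible: the total would be both `n` and 0.
  obtain ⟨w, hw⟩ := hsurj fun k => Sum.elim 1 0 k
  have hrow : ∀ i, ∑ j, w (i, j) = 1 := fun i => by
    simpa [marginals] using congrFun hw (.inl i)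
  have hcol : ∀ j, ∑ i, w (i, j) = 0 := fun j => by
    simpa [marginals] using congrFun hw (.inr (.inl j))
  have := Finset.sum_comm (s := Finset.univ) (t := Finset.univ) (f := fun i j => w (i, j))
  simp only [hrow, hcol] at this
  simp at this
  omega

/-- If all moments vanished, each column moment would be a combination of the marginals. Its
coefficients then separate the cells of `T` in column `j₀` while being constant on `T` in every
other column, which forces `w` to vanish. -/
theorem exists_moment_ne_zero {n : ℕ} (hn : 0 < n) {T : Finset (Fin n × Fin n)}
    (hT : 2 * n ≤ T.card) :
    ∃ w ∈ ⨅ k, LinearMap.ker (marginals T k), ∃ j₀, ∑ i : Fin n, ((i : ℕ) : ℚ) * w (i, j₀) ≠ 0 := by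
  obtain ⟨w, hw, hw0⟩ := exists_mem_iInf_ker_marginals_ne_zero hn hT
  obtain ⟨hrow, hcol, hoff⟩ := mem_iInf_ker_marginals.mp hw
  by_contra! h
  apply hw0
  ext ⟨i₀, j₀⟩
  let K : (Fin n × Fin n → ℚ) →ₗ[ℚ] ℚ := ∑ i : Fin n, ((i : ℕ) : ℚ) • LinearMap.proj (i, j₀)
  have hK : K ∈ Submodule.span ℚ (Set.range (marginals T)) :=
    mem_span_of_iInf_ker_le_ker fun v hv => by simpa [K] using h v hv j₀
  obtain ⟨c, hc⟩ := (Submodule.mem_span_range_iff_exists_fun ℚ).mp hK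
  have key : ∀ i j, (i, j) ∈ T →
      c (.inl i) + c (.inr (.inl j)) = if j = j₀ then ((i : ℕ) : ℚ) else 0 := by
    intro i j hij
    have h1 := congrArg (fun f => f (Pi.single (i, j) 1)) hc
    have h2 : ∑ p : {p // p ∉ T}, c (.inr (.inr p)) * (Pi.single (i, j) 1 : _ → ℚ) p.1 = 0 :=
      Finset.sum_eq_zero fun p _ => by
        rw [Pi.single_eq_of_ne (fun e => p.2 (by rwa [e])), mul_zero]
    simp only [Fintype.sum_sum_type, marginals, LinearMap.add_apply, LinearMap.sum_apply,
      LinearMap.smul_apply, LinearMap.proj_apply, smul_eq_mul, h2, K] at h1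
    simp only [Pi.single_apply, Prod.mk.injEq] at h1
    simp only [ite_and, Finset.sum_ite_eq', Finset.mem_univ, if_true, mul_ite,
      mul_one, mul_zero, Finset.sum_ite_irrel, Finset.sum_const_zero, add_zero] at h1
    simpa [eq_comm] using h1
  by_cases hT0 : (i₀, j₀) ∈ T
  swap
  · exact hoff _ hT0
  -- Weighting row `i` by `g (c (.inl i))` keeps row sums zero. Columns other than `j₀` contribute a
  -- constant times a zero column sum, and column `j₀` contributes only `w (i₀, j₀)`.
  set g : ℚ → ℚ := fun t => if t = c (.inl i₀) then 1 else 0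
  have hzero : ∑ j, ∑ i, w (i, j) * g (c (.inl i)) = 0 := by
    rw [Finset.sum_comm]
    exact Finset.sum_eq_zero fun i _ => by rw [← Finset.sum_mul, hrow, zero_mul]
  rw [Finset.sum_eq_single j₀, Finset.sum_eq_single i₀] at hzero
  · simpa [g] using hzero
  · intro i _ hi
    by_cases hij : (i, j₀) ∈ T
    · have h1 := key i j₀ hij
      have h2 := key i₀ j₀ hT0
      rw [if_pos rfl] at h1 h2
      have : c (.inl i) ≠ c (.inl i₀) := by
        intro e
        rw [e, h2] at h1
        exact hi (Fin.ext (by exact_mod_cast h1.symm))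
      simp [g, this]
    · rw [hoff _ hij, zero_mul]
  · simp
  · intro j _ hj
    rw [← zero_mul (g (-c (.inr (.inl j)))), ← hcol j, Finset.sum_mul]
    refine Finset.sum_congr rfl fun i _ => ?_
    by_cases hij : (i, j) ∈ T
    · have h1 := key i j hij
      rw [if_neg hj] at h1
      rw [eq_neg_of_add_eq_zero_left h1]
    · rw [hoff _ hij, zero_mul, zero_mul]
  · simp

/-- The integral form of `exists_moment_ne_zero`, with the relation split into its positive and
negative parts. -/
theorem exists_exponents {n : ℕ} (hn : 0 < n) {T : Finset (Fin n × Fin n)}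
    (hT : 2 * n ≤ T.card) :
    ∃ a b : Fin n → Fin n → ℕ, (∀ p ∉ T, a p.1 p.2 = 0 ∧ b p.1 p.2 = 0) ∧
      (∀ i, ∑ j, a i j = ∑ j, b i j) ∧ (∀ j, ∑ i, a i j = ∑ i, b i j) ∧
      ∃ j₀, ∑ i : Fin n, (i : ℕ) * a i j₀ ≠ ∑ i : Fin n, (i : ℕ) * b i j₀ := by
  obtain ⟨w, hw, j₀, hj₀⟩ := exists_moment_ne_zero hn hT
  obtain ⟨hrow, hcol, hoff⟩ := mem_iInf_ker_marginals.mp hw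
  obtain ⟨d, hd⟩ := IsLocalization.exist_integer_multiples_of_finite (nonZeroDivisors ℤ) w
  choose z hz using hd
  have hd0 : ((d : ℤ) : ℚ) ≠ 0 := by exact_mod_cast nonZeroDivisors.ne_zero d.2
  replace hz : ∀ p, (z p : ℚ) = (d : ℤ) * w p := fun p => by simpa using hz p
  have hab : ∀ p, (((z p).toNat : ℕ) : ℚ) - (((-z p).toNat : ℕ) : ℚ) = (d : ℤ) * w p := by
    intro p
    rw [← hz]
    exact_mod_cast Int.toNat_sub_toNat_neg (z p)
  refine ⟨fun i j => (z (i, j)).toNat, fun i j => (-z (i, j)).toNat, ?_, ?_, ?_, j₀, ?_⟩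
  · intro p hp
    have : z p = 0 := by
      have := hz p
      rw [hoff p hp, mul_zero] at this
      exact_mod_cast this
    simp [this]
  · intro i
    have : ∑ j, ((((z (i, j)).toNat : ℕ) : ℚ) - (((-z (i, j)).toNat : ℕ) : ℚ)) = 0 := by
      simp_rw [hab, ← Finset.mul_sum, hrow, mul_zero]
    rw [Finset.sum_sub_distrib, sub_eq_zero] at this
    exact_mod_cast this
  · intro j
    have : ∑ i, ((((z (i, j)).toNat : ℕ) : ℚ) - (((-z (i, j)).toNat : ℕ) : ℚ)) = 0 := by
      simp_rw [hab, ← Finset.mul_sum, hcol, mul_zero]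
    rw [Finset.sum_sub_distrib, sub_eq_zero] at this
    exact_mod_cast this
  · intro e
    apply hj₀
    have : ∑ i : Fin n, ((i : ℕ) : ℚ) *
        ((((z (i, j₀)).toNat : ℕ) : ℚ) - (((-z (i, j₀)).toNat : ℕ) : ℚ)) = 0 := by
      simp_rw [mul_sub, Finset.sum_sub_distrib, sub_eq_zero]
      exact_mod_cast e
    simp_rw [hab, mul_left_comm _ ((d : ℤ) : ℚ), ← Finset.mul_sum] at this
    exact (mul_eq_zero.mp this).resolve_left hd0

theorem prod_vecMulVec_pow {n : ℕ} (u v : Fin n → ℂ) (a : Fin n → Fin n → ℕ) :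
    ∏ i, ∏ j, vecMulVec u v i j ^ a i j = (∏ i, u i ^ ∑ j, a i j) * ∏ j, v j ^ ∑ i, a i j := by
  simp_rw [vecMulVec_apply, mul_pow, Finset.prod_mul_distrib, Finset.prod_pow_eq_pow_sum]
  rw [Finset.prod_comm (f := fun i j => v j ^ a i j)]
  simp_rw [Finset.prod_pow_eq_pow_sum]

theorem exists_binomial {n : ℕ} (hn : 0 < n) {T : Finset (Fin n × Fin n)}
    (hT : 2 * n ≤ T.card) :
    ∃ Q : MvPolynomial (Fin n × Fin n) ℂ, pullback n Q ≠ 0 ∧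
      ∀ M A : Matrix (Fin n) (Fin n) ℂ, A.rank ≤ 1 → (∀ p ∈ T, M p.1 p.2 = A p.1 p.2) →
        evalAt M Q = 0 := by
  obtain ⟨a, b, hoff, hrow, hcol, j₀, hj₀⟩ := exists_exponents hn hT
  refine ⟨∏ i, ∏ j, MvPolynomial.X (i, j) ^ a i j - ∏ i, ∏ j, MvPolynomial.X (i, j) ^ b i j,
    ?_, ?_⟩
  -- At this point both monomials become powers of 2 whose exponents are the two moments of column
  -- `j₀`.
  · apply ne_zero_of_eval_ne_zero (x := fun j => if j = j₀ then 2 else 1)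
    rw [eval_pullback]
    have h : ∀ a : Fin n → Fin n → ℕ,
        (∏ i : Fin n, ∏ j, (((if j = j₀ then 2 else 1 : ℂ) ^ (i : ℕ)) ^ a i j)) =
          ((2 ^ ∑ i : Fin n, (i : ℕ) * a i j₀ : ℕ) : ℂ) := by
      intro a
      simp [← pow_mul, ite_pow, Finset.prod_pow_eq_pow_sum]
    simp only [evalAt, map_sub, map_prod, map_pow, MvPolynomial.eval_X, transpose_apply,
      vandermonde_apply, h, sub_ne_zero]
    exact_mod_cast fun e => hj₀ (Nat.pow_right_injective le_rfl e)
  · intro M A hA hM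
    obtain ⟨u, v, rfl⟩ := exists_eq_vecMulVec hA
    have h : ∀ a : Fin n → Fin n → ℕ, (∀ p ∉ T, a p.1 p.2 = 0) →
        ∏ i, ∏ j, M i j ^ a i j = ∏ i, ∏ j, vecMulVec u v i j ^ a i j := by
      intro a ha
      refine Finset.prod_congr rfl fun i _ => Finset.prod_congr rfl fun j _ => ?_
      by_cases hij : (i, j) ∈ T
      · rw [hM _ hij]
      · rw [ha _ hij, pow_zero, pow_zero]
    simp only [evalAt, map_sub, map_prod, map_pow, MvPolynomial.eval_X]
    rw [h a fun p hp => (hoff p hp).1, h b fun p hp => (hoff p hp).2, prod_vecMulVec_pow,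
      prod_vecMulVec_pow]
    simp_rw [hrow, hcol, sub_self]

theorem exists_pullback_ne_zero_one {n : ℕ} (hn : 2 ≤ n) :
    ∃ Q : MvPolynomial (Fin n × Fin n) ℂ, pullback n Q ≠ 0 ∧
      ∀ M ∈ rigiditySet n 1 (n ^ 2 - 2 * n), evalAt M Q = 0 := by
  classical
  choose Q hQ hQM using fun T : {T : Finset (Fin n × Fin n) // 2 * n ≤ T.card} =>
    exists_binomial (by omega) T.2
  refine ⟨∏ T, Q T, by rw [map_prod]; exact Finset.prod_ne_zero_iff.mpr fun T _ => hQ T, ?_⟩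
  intro M hM
  obtain ⟨A, B, hA, hB, rfl⟩ := exists_decomposition hM
  have hcard : 2 * n ≤ (Finset.univ.filter fun p : Fin n × Fin n => B p.1 p.2 ≠ 0)ᶜ.card := by
    rw [Finset.card_compl, Fintype.card_prod, Fintype.card_fin, ← pow_two]
    have : 2 * n ≤ n ^ 2 := by rw [pow_two]; exact Nat.mul_le_mul_right n hn
    omega
  rw [evalAt, map_prod]
  refine Finset.prod_eq_zero (Finset.mem_univ ⟨_, hcard⟩) (hQM _ _ A hA fun p hp => ?_)
  simpa using hp

/-! ### Rank `n - 2`: relations on the adjugate -/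

/-- The difference of the two three-cycle products of the entries of `C` in the rows `j` and the
columns `i`. -/
def cycleForm {R : Type*} [CommRing R] {n : ℕ} (C : Matrix (Fin n) (Fin n) R)
    (i j : Fin 3 → Fin n) : R :=
  C (j 0) (i 1) * C (j 1) (i 2) * C (j 2) (i 0) - C (j 0) (i 2) * C (j 2) (i 1) * C (j 1) (i 0)

theorem cycleForm_eq_zero_of_rank_le_one {n : ℕ} {C : Matrix (Fin n) (Fin n) ℂ}
    (hC : C.rank ≤ 1) (i j : Fin 3 → Fin n) : cycleForm C i j = 0 := by
  obtain ⟨u, v, rfl⟩ := exists_eq_vecMulVec hC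
  simp only [cycleForm, vecMulVec_apply]
  ring

theorem finrank_ker_mulVecLin_add_rank {m n : ℕ} (A : Matrix (Fin m) (Fin n) ℂ) :
    Module.finrank ℂ (LinearMap.ker A.mulVecLin) + A.rank = n := by
  have := LinearMap.finrank_range_add_finrank_ker A.mulVecLin
  rw [Module.finrank_fin_fun] at this
  rw [rank]
  omega

/-- The kernel has dimension at least 2, so it contains a nonzero vector with `i`-th coordinate 0;
this vector also kills the matrix whose determinant is the cofactor. -/
theorem adjugate_eq_zero_of_rank_le {n : ℕ} (hn : 2 ≤ n) {A : Matrix (Fin n) (Fin n) ℂ}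
    (hA : A.rank ≤ n - 2) : A.adjugate = 0 := by
  ext i j
  rw [adjugate_apply, Matrix.zero_apply, ← exists_mulVec_eq_zero_iff]
  have hker := finrank_ker_mulVecLin_add_rank A
  have hf : LinearMap.ker ((LinearMap.proj i : (Fin n → ℂ) →ₗ[ℂ] ℂ).domRestrict
      (LinearMap.ker A.mulVecLin)) ≠ ⊥ :=
    LinearMap.ker_ne_bot_of_finrank_lt (by rw [Module.finrank_self]; omega)
  obtain ⟨⟨v, hv⟩, hvi, hv0⟩ := Submodule.exists_mem_ne_zero_of_ne_bot hf
  refine ⟨v, fun h => hv0 (Subtype.ext h), ?_⟩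
  have hvi' : v i = 0 := hvi
  have hAv : A *ᵥ v = 0 := hv
  ext k
  rw [mulVec]
  by_cases hk : k = j
  · subst hk
    simp [hvi']
  · rw [updateRow_ne hk]
    exact congrFun hAv k

theorem adjugate_apply_eq_of_forall_ne {n : ℕ} {A B : Matrix (Fin n) (Fin n) ℂ} {i₀ j₀ : Fin n}
    (hB : ∀ i j, i ≠ i₀ → j ≠ j₀ → B i j = 0) :
    (A + B).adjugate j₀ i₀ = A.adjugate j₀ i₀ := by
  obtain _ | m := n
  · exact i₀.elim0
  rw [adjugate_fin_succ_eq_det_submatrix, adjugate_fin_succ_eq_det_submatrix]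
  congr 2
  ext i j
  simp [hB _ _ (Fin.succAbove_ne i₀ i) (Fin.succAbove_ne j₀ j)]

theorem rank_adjugate_le_one {n : ℕ} (hn : 2 ≤ n) {M : Matrix (Fin n) (Fin n) ℂ}
    (hM : M.det = 0) : M.adjugate.rank ≤ 1 := by
  by_cases h : M.rank ≤ n - 2
  · simp [adjugate_eq_zero_of_rank_le hn h]
  · have := rank_add_rank_le_card_of_mul_eq_zero
      (show M * M.adjugate = 0 by rw [mul_adjugate, hM, zero_smul])
    rw [Fintype.card_fin] at this
    omega

/-- Off the diagonal `-b s * C s t = u s * v t`, so both cycle products, times `b 0 * b 1 * b 2`,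
equal `-∏ u s * v s`. If some `b s` is 0, row `s` is a unit vector, and rank one makes the two
entries of `C` joining the other indices vanish, one in each product. -/
theorem cycle_eq_of_rank_le_one {C : Matrix (Fin 3) (Fin 3) ℂ} {b : Fin 3 → ℂ}
    (h : (1 - diagonal b * C).rank ≤ 1) :
    C 0 1 * C 1 2 * C 2 0 = C 0 2 * C 2 1 * C 1 0 := by
  obtain ⟨u, v, h⟩ := exists_eq_vecMulVec h
  have e : ∀ s t, (1 : Matrix (Fin 3) (Fin 3) ℂ) s t - b s * C s t = u s * v t := fun s t => by
    simpa [vecMulVec_apply, diagonal_mul] using congrFun (congrFun h s) t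
  have e00 := e 0 0
  have e01 := e 0 1
  have e02 := e 0 2
  have e10 := e 1 0
  have e11 := e 1 1
  have e12 := e 1 2
  have e20 := e 2 0
  have e21 := e 2 1
  have e22 := e 2 2
  simp at e00 e01 e02 e10 e11 e12 e20 e21 e22
  by_cases h0 : b 0 = 0
  · have : C 1 2 = 0 := by grind
    have : C 2 1 = 0 := by grind
    grind
  by_cases h1 : b 1 = 0
  · have : C 0 2 = 0 := by grind
    have : C 2 0 = 0 := by grind
    grind
  by_cases h2 : b 2 = 0
  · have : C 0 1 = 0 := by grind
    have : C 1 0 = 0 := by grind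
    grind
  apply mul_left_cancel₀ (mul_ne_zero (mul_ne_zero h0 h1) h2)
  linear_combination -e01 * (b 1 * C 1 2) * (b 2 * C 2 0) + u 0 * v 1 * e12 * (b 2 * C 2 0)
    - u 0 * v 1 * u 1 * v 2 * e20 + e02 * (b 1 * C 1 0) * (b 2 * C 2 1)
    - u 0 * v 2 * e10 * (b 2 * C 2 1) + u 0 * v 2 * u 1 * v 0 * e21

/-- `F` embeds the kernel of `M - E * F` into that of `1 - F * M⁻¹ * E`, since `M v = E F v`
recovers `v` from `F v`. -/
theorem rank_one_sub_mul_inv_mul_le {m n : ℕ} {M : Matrix (Fin n) (Fin n) ℂ} (hM : IsUnit M.det)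
    (E : Matrix (Fin n) (Fin m) ℂ) (F : Matrix (Fin m) (Fin n) ℂ) :
    (1 - F * M⁻¹ * E).rank + n ≤ (M - E * F).rank + m := by
  have hsol : ∀ v ∈ LinearMap.ker (M - E * F).mulVecLin, v = M⁻¹ *ᵥ (E *ᵥ (F *ᵥ v)) := by
    intro v hv
    rw [LinearMap.mem_ker, mulVecLin_apply, sub_mulVec, sub_eq_zero, ← mulVec_mulVec] at hv
    rw [← hv, mulVec_mulVec, nonsing_inv_mul _ hM, one_mulVec]
  have hmaps : ∀ v ∈ LinearMap.ker (M - E * F).mulVecLin,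
      F.mulVecLin v ∈ LinearMap.ker (1 - F * M⁻¹ * E).mulVecLin := by
    intro v hv
    rw [LinearMap.mem_ker, mulVecLin_apply, mulVecLin_apply, sub_mulVec, one_mulVec,
      ← mulVec_mulVec, ← mulVec_mulVec, ← hsol v hv, sub_self]
  have hinj : Function.Injective (F.mulVecLin.restrict hmaps) := by
    rw [← LinearMap.ker_eq_bot, eq_bot_iff]
    rintro ⟨v, hv⟩ h
    have hFv : F *ᵥ v = 0 := congrArg Subtype.val h
    have := hsol v hv
    rw [hFv, mulVec_zero, mulVec_zero] at this
    exact Subtype.ext this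
  have h := LinearMap.finrank_le_finrank_of_injective hinj
  have h1 := finrank_ker_mulVecLin_add_rank (M - E * F)
  have h2 := finrank_ker_mulVecLin_add_rank (1 - F * M⁻¹ * E)
  omega

theorem cycleForm_adjugate_eq_zero {n : ℕ} (hn : 2 ≤ n) {A : Matrix (Fin n) (Fin n) ℂ}
    (hA : A.rank ≤ n - 2) (i j : Fin 3 → Fin n) (b : Fin 3 → ℂ) :
    cycleForm (A + ∑ s, single (i s) (j s) (b s)).adjugate i j = 0 := by
  set M := A + ∑ s, single (i s) (j s) (b s) with hM
  by_cases hdet : M.det = 0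
  · exact cycleForm_eq_zero_of_rank_le_one (rank_adjugate_le_one hn hdet) i j
  have hunit : IsUnit M.det := isUnit_iff_ne_zero.mpr hdet
  -- The three-cell change factors through a 3-dimensional space, so rank at most `n - 2` for `A`
  -- leaves rank at most 1 for a 3 × 3 matrix.
  let E : Matrix (Fin n) (Fin 3) ℂ := of fun k s => if k = i s then 1 else 0
  let F : Matrix (Fin 3) (Fin n) ℂ := of fun s k => if k = j s then b s else 0
  have hEF : M - E * F = A := by
    rw [sub_eq_iff_eq_add, hM]
    congr 1
    ext k l
    simp [E, F, mul_apply, Matrix.sum_apply, single_apply, ← ite_and, and_comm, eq_comm]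
  have hFE : F * M⁻¹ * E = diagonal b * M⁻¹.submatrix j i := by
    ext s t
    rw [diagonal_mul]
    simp [E, F, mul_apply]
  have h := rank_one_sub_mul_inv_mul_le hunit E F
  rw [hEF, hFE] at h
  have h3 := cycle_eq_of_rank_le_one (show (1 - diagonal b * M⁻¹.submatrix j i).rank ≤ 1 by omega)
  have hadj : M.adjugate = M.det • M⁻¹ := by
    rw [inv_def, Ring.inverse_eq_inv', smul_smul, mul_inv_cancel₀ hdet, one_smul]
  simp only [submatrix_apply] at h3
  simp only [cycleForm, hadj, Matrix.smul_apply, smul_eq_mul]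
  linear_combination M.det ^ 3 * h3

/-- Three cells either lie in the union of a row and a column, or lie in distinct rows and distinct
columns. -/
theorem covered_or_distinct {n : ℕ} {S : Finset (Fin n × Fin n)} (hn : 0 < n) (hS : S.card ≤ 3) :
    (∃ i₀ j₀, ∀ p ∈ S, p.1 = i₀ ∨ p.2 = j₀) ∨
    ∃ i j : Fin 3 → Fin n, Function.Injective i ∧ Function.Injective j ∧
      S = Finset.univ.image fun s => (i s, j s) := by
  by_cases hc : ∃ i₀ j₀, ∀ p ∈ S, p.1 = i₀ ∨ p.2 = j₀
  · exact .inl hc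
  right
  push Not at hc
  obtain ⟨p, hp, -, -⟩ := hc ⟨0, hn⟩ ⟨0, hn⟩
  obtain ⟨q, hq, hq1, hq2⟩ := hc p.1 p.2
  obtain ⟨r, hr, hr1, hr2⟩ := hc p.1 q.2
  obtain ⟨r', hr', hr1', hr2'⟩ := hc q.1 p.2
  have hpq : p ≠ q := fun h => hq1 (by rw [h])
  have hpr : p ≠ r := fun h => hr1 (by rw [h])
  have hqr : q ≠ r := fun h => hr2 (by rw [h])
  have hcard : ({p, q, r} : Finset (Fin n × Fin n)).card = 3 := Finset.card_eq_three.mpr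
    ⟨p, q, r, hpq, hpr, hqr, rfl⟩
  have hSeq : {p, q, r} = S := Finset.eq_of_subset_of_card_le
    (by simp [Finset.insert_subset_iff, hp, hq, hr]) (by omega)
  have hrr : r' = r := by
    rw [← hSeq] at hr'
    simp only [Finset.mem_insert, Finset.mem_singleton] at hr'
    rcases hr' with rfl | rfl | rfl
    · exact absurd rfl hr2'
    · exact absurd rfl hr1'
    · rfl
  subst hrr
  refine ⟨![p.1, q.1, r'.1], ![p.2, q.2, r'.2], ?_, ?_, ?_⟩
  · intro s t
    fin_cases s <;> fin_cases t <;> simp [hq1, hr1, hr1', hq1.symm, hr1.symm, hr1'.symm]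
  · intro s t
    fin_cases s <;> fin_cases t <;> simp [hq2, hr2, hr2', hq2.symm, hr2.symm, hr2'.symm]
  · rw [← hSeq]
    ext x
    simp [Fin.exists_fin_succ, eq_comm]

theorem exists_adjugate_or_cycleForm_eq_zero {n : ℕ} (hn : 2 ≤ n) {M : Matrix (Fin n) (Fin n) ℂ}
    (hM : M ∈ rigiditySet n (n - 2) 3) :
    (∃ i j, M.adjugate i j = 0) ∨ ∃ i j : Fin 3 → Fin n, Function.Injective i ∧
      Function.Injective j ∧ cycleForm M.adjugate i j = 0 := by
  obtain ⟨A, B, hA, hB, rfl⟩ := exists_decomposition hM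
  rcases covered_or_distinct (by omega) hB with ⟨i₀, j₀, h⟩ | ⟨i, j, hi, hj, h⟩
  · refine .inl ⟨j₀, i₀, ?_⟩
    rw [adjugate_apply_eq_of_forall_ne, adjugate_eq_zero_of_rank_le hn hA, Matrix.zero_apply]
    intro i j hi hj
    by_contra hij
    exact (h (i, j) (by simpa using hij)).elim hi hj
  · refine .inr ⟨i, j, hi, hj, ?_⟩
    have hBsum : B = ∑ s, single (i s) (j s) (B (i s) (j s)) := by
      ext k l
      rw [Matrix.sum_apply]
      by_cases hkl : ∃ s, (i s, j s) = (k, l)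
      · obtain ⟨s, hs⟩ := hkl
        obtain ⟨rfl, rfl⟩ := Prod.mk.inj hs
        rw [Finset.sum_eq_single s]
        · simp
        · intro t _ hts
          simp [hi.ne hts]
        · simp
      · have hB0 : B k l = 0 := by
          by_contra hne
          have : (k, l) ∈ Finset.univ.image fun s => (i s, j s) := h ▸ (by simpa using hne)
          exact hkl (by simpa using this)
        rw [hB0, Finset.sum_eq_zero]
        intro s _
        rw [single_apply, if_neg]
        rintro ⟨rfl, rfl⟩
        exact hkl ⟨s, rfl⟩
    rw [hBsum]
    exact cycleForm_adjugate_eq_zero hn hA i j _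

/-! ### The adjugate of a Vandermonde matrix -/

/-- The matrix whose row `j` lists the coefficients of `∏_{k ≠ j} (X - x_k)`. -/
noncomputable def nodalMatrix {R : Type*} [CommRing R] {n : ℕ} (x : Fin n → R) :
    Matrix (Fin n) (Fin n) R :=
  of fun j i => (Lagrange.nodal (Finset.univ.erase j) x).coeff i

theorem map_nodalMatrix_X {n : ℕ} (x : Fin n → ℂ) (j i : Fin n) :
    MvPolynomial.eval x (nodalMatrix (MvPolynomial.X : Fin n → MvPolynomial (Fin n) ℂ) j i) =
      nodalMatrix x j i := by
  simp only [nodalMatrix, of_apply]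
  rw [← Polynomial.coeff_map]
  simp [Lagrange.nodal, Polynomial.map_prod]

theorem nodalMatrix_mul_transpose_vandermonde {n : ℕ} (x : Fin n → ℂ) :
    nodalMatrix x * (vandermonde x)ᵀ = diagonal fun j => ∏ k ∈ Finset.univ.erase j, (x j - x k) := by
  ext j k
  have hdeg : (Lagrange.nodal (Finset.univ.erase j) x).natDegree < n := by
    rw [Lagrange.natDegree_nodal, Finset.card_erase_of_mem (Finset.mem_univ j), Finset.card_univ,
      Fintype.card_fin]
    exact Nat.sub_lt j.pos one_pos
  have h := Polynomial.eval_eq_sum_range' hdeg (x k)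
  rw [← Fin.sum_univ_eq_sum_range
    (fun i => (Lagrange.nodal (Finset.univ.erase j) x).coeff i * x k ^ i)] at h
  simp only [mul_apply, transpose_apply, vandermonde_apply, nodalMatrix, of_apply]
  rw [← h]
  by_cases hjk : j = k
  · subst hjk
    rw [diagonal_apply_eq, Lagrange.eval_nodal]
  · rw [diagonal_apply_ne _ hjk]
    exact Lagrange.eval_nodal_at_node (by simp [Ne.symm hjk])

theorem adjugate_transpose_vandermonde {n : ℕ} {x : Fin n → ℂ} (hx : Function.Injective x) :
    ∃ c : Fin n → ℂ, (∀ j, c j ≠ 0) ∧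
      ∀ j i, (vandermonde x)ᵀ.adjugate j i = c j * nodalMatrix x j i := by
  have hdet : (vandermonde x)ᵀ.det ≠ 0 := by
    rw [det_transpose]
    exact det_vandermonde_ne_zero_iff.mpr hx
  have hw : ∀ j, ∏ k ∈ Finset.univ.erase j, (x j - x k) ≠ 0 := fun j =>
    Finset.prod_ne_zero_iff.mpr fun k hk => sub_ne_zero.mpr (hx.ne (Finset.ne_of_mem_erase hk).symm)
  refine ⟨fun j => (vandermonde x)ᵀ.det / ∏ k ∈ Finset.univ.erase j, (x j - x k),
    fun j => div_ne_zero hdet (hw j), fun j i => ?_⟩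
  have h := congrArg (fun N => (N * (vandermonde x)ᵀ.adjugate) j i)
    (nodalMatrix_mul_transpose_vandermonde x)
  simp only [Matrix.mul_assoc, mul_adjugate, diagonal_mul] at h
  rw [mul_smul_comm, Matrix.mul_one, Matrix.smul_apply, smul_eq_mul] at h
  rw [div_mul_eq_mul_div, eq_div_iff (hw j), h, mul_comm]

/-- This passes from 0/1 points, where nodes coincide, to distinct nodes, where the adjugate formula
applies. -/
theorem exists_injective_eval_ne_zero {n : ℕ} {P : MvPolynomial (Fin n) ℂ} (hP : P ≠ 0) :
    ∃ x : Fin n → ℂ, Function.Injective x ∧ MvPolynomial.eval x P ≠ 0 := by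
  have hV : (vandermonde (MvPolynomial.X : Fin n → MvPolynomial (Fin n) ℂ)).det ≠ 0 :=
    det_vandermonde_ne_zero_iff.mpr (MvPolynomial.X_injective)
  obtain ⟨x, hx⟩ := exists_eval_ne_zero (mul_ne_zero hV hP)
  rw [map_mul] at hx
  refine ⟨x, ?_, right_ne_zero_of_mul hx⟩
  rw [← det_vandermonde_ne_zero_iff]
  convert left_ne_zero_of_mul hx using 1
  simp [det_vandermonde, map_prod]

/-- At a 0/1 point the nodal polynomial is `(X - 1) ^ a * X ^ (n - 1 - a)` with `a = (U.erase
j).card`, whose nonzero coefficients are exactly those of degree `n - 1 - a` to `n - 1`. -/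
theorem nodalMatrix_indicator_ne_zero_iff {n : ℕ} (U : Finset (Fin n)) (j i : Fin n) :
    nodalMatrix (fun k => if k ∈ U then (1 : ℂ) else 0) j i ≠ 0 ↔ n ≤ i + 1 + (U.erase j).card := by
  have hcard : ((Finset.univ.erase j).filter (· ∈ U)).card = (U.erase j).card := by
    congr 1
    ext
    simp [and_comm]
  have hcard' := Finset.card_filter_add_card_filter_not (s := Finset.univ.erase j) (· ∈ U)
  rw [hcard, Finset.card_erase_of_mem (Finset.mem_univ j), Finset.card_univ,
    Fintype.card_fin] at hcard'
  have h : Lagrange.nodal (Finset.univ.erase j) (fun k => if k ∈ U then (1 : ℂ) else 0) =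
      (Polynomial.X - Polynomial.C 1) ^ (U.erase j).card *
        Polynomial.X ^ ((Finset.univ.erase j).filter (· ∉ U)).card := by
    rw [Lagrange.nodal, ← Finset.prod_filter_mul_prod_filter_not _ (· ∈ U), ← hcard]
    congr 1
    · rw [← Finset.prod_const]
      exact Finset.prod_congr rfl fun k hk => by simp [(Finset.mem_filter.mp hk).2]
    · rw [← Finset.prod_const]
      exact Finset.prod_congr rfl fun k hk => by simp [(Finset.mem_filter.mp hk).2]
  have hi := i.2
  rw [nodalMatrix, of_apply, h, Polynomial.coeff_mul_X_pow']
  split_ifs with hle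
  · rw [sub_eq_add_neg, ← Polynomial.C_neg, Polynomial.coeff_X_add_C_pow]
    refine iff_of_true (mul_ne_zero (pow_ne_zero _ (by simp)) ?_) (by omega)
    exact_mod_cast (Nat.choose_pos (by omega)).ne'
  · exact iff_of_false (by simp) (by omega)

theorem exists_cycle_ne {n : ℕ} {i₀ i₁ i₂ j₀ j₁ j₂ : Fin n} (h0 : i₂ < i₀) (h1 : i₂ < i₁)
    (hi : i₀ ≠ i₁) (hj01 : j₀ ≠ j₁) (hj12 : j₁ ≠ j₂) :
    ∃ x : Fin n → ℂ,
      nodalMatrix x j₀ i₁ * nodalMatrix x j₁ i₂ * nodalMatrix x j₂ i₀ ≠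
        nodalMatrix x j₀ i₂ * nodalMatrix x j₂ i₁ * nodalMatrix x j₁ i₀ := by
  have hi' : (i₀ : ℕ) ≠ i₁ := fun e => hi (Fin.ext e)
  have h0' : (i₂ : ℕ) < i₀ := h0
  have h1' : (i₂ : ℕ) < i₁ := h1
  have hlt0 := i₀.2
  have hlt1 := i₁.2
  -- With this size of `U`, row `j₁` has nonzero entries from column `i₂` on, rows `j₀` and `j₂`
  -- only from `i₂ + 1` on. Hence only the right-hand product vanishes.
  obtain ⟨U, hjU, hUj, hU⟩ := Finset.exists_subsuperset_card_eq
    (s := {j₀, j₂}) (t := Finset.univ.erase j₁) (n := n - 1 - i₂)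
    (by simp [Finset.insert_subset_iff, hj01, hj12.symm])
    (Finset.card_le_two.trans (by omega)) (by
      rw [Finset.card_erase_of_mem (Finset.mem_univ _), Finset.card_univ, Fintype.card_fin]; omega)
  have hc0 : (U.erase j₀).card = n - 1 - i₂ - 1 := by
    rw [Finset.card_erase_of_mem (hjU (by simp)), hU]
  have hc2 : (U.erase j₂).card = n - 1 - i₂ - 1 := by
    rw [Finset.card_erase_of_mem (hjU (by simp)), hU]
  have hc1 : (U.erase j₁).card = n - 1 - i₂ := by
    rw [Finset.erase_eq_of_notMem fun h => by simpa using hUj h, hU]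
  refine ⟨fun k => if k ∈ U then 1 else 0, ?_⟩
  have hz : nodalMatrix (fun k => if k ∈ U then (1 : ℂ) else 0) j₀ i₂ = 0 := by
    rw [← not_not (a := _ = _), ← ne_eq, nodalMatrix_indicator_ne_zero_iff]
    omega
  rw [hz, zero_mul, zero_mul]
  refine mul_ne_zero (mul_ne_zero ?_ ?_) ?_ <;>
  · rw [nodalMatrix_indicator_ne_zero_iff]
    omega

theorem exists_cycleForm_nodalMatrix_ne_zero {n : ℕ} {i j : Fin 3 → Fin n}
    (hi : Function.Injective i) (hj : Function.Injective j) :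
    ∃ x : Fin n → ℂ, cycleForm (nodalMatrix x) i j ≠ 0 := by
  have hi01 : i 0 ≠ i 1 := hi.ne (by decide)
  have hi02 : i 0 ≠ i 2 := hi.ne (by decide)
  have hi12 : i 1 ≠ i 2 := hi.ne (by decide)
  have hj01 : j 0 ≠ j 1 := hj.ne (by decide)
  have hj02 : j 0 ≠ j 2 := hj.ne (by decide)
  have hj12 : j 1 ≠ j 2 := hj.ne (by decide)
  simp only [cycleForm, sub_ne_zero]
  -- The cycle form is invariant under simultaneous rotation of `i` and `j`, so the least column may
  -- be put last.
  have hmin : (i 2 < i 0 ∧ i 2 < i 1) ∨ (i 0 < i 1 ∧ i 0 < i 2) ∨ (i 1 < i 2 ∧ i 1 < i 0) := by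
    omega
  rcases hmin with ⟨h, h'⟩ | ⟨h, h'⟩ | ⟨h, h'⟩
  · exact exists_cycle_ne h h' hi01 hj01 hj12
  · obtain ⟨x, hx⟩ := exists_cycle_ne h h' hi12 hj12 hj02.symm
    exact ⟨x, fun e => hx (by linear_combination e)⟩
  · obtain ⟨x, hx⟩ := exists_cycle_ne h h' hi02.symm hj02.symm hj01
    exact ⟨x, fun e => hx (by linear_combination e)⟩

/-! ### The polynomial for rank `n - 2` -/

theorem evalAt_adjugate {n : ℕ} (M : Matrix (Fin n) (Fin n) ℂ) (i j : Fin n) :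
    evalAt M ((mvPolynomialX (Fin n) (Fin n) ℂ).adjugate i j) = M.adjugate i j := by
  have h := RingHom.map_adjugate (MvPolynomial.eval fun p : Fin n × Fin n => M p.1 p.2)
    (mvPolynomialX (Fin n) (Fin n) ℂ)
  rw [mvPolynomialX_mapMatrix_eval] at h
  rw [← h]
  rfl

theorem evalAt_cycleForm {n : ℕ} (M : Matrix (Fin n) (Fin n) ℂ) (i j : Fin 3 → Fin n) :
    evalAt M (cycleForm (mvPolynomialX (Fin n) (Fin n) ℂ).adjugate i j) =
      cycleForm M.adjugate i j := by
  simp only [cycleForm, ← evalAt_adjugate]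
  simp only [evalAt, map_sub, map_mul]

theorem pullback_adjugate_ne_zero {n : ℕ} (i j : Fin n) :
    pullback n ((mvPolynomialX (Fin n) (Fin n) ℂ).adjugate j i) ≠ 0 := by
  have hP : nodalMatrix (MvPolynomial.X : Fin n → MvPolynomial (Fin n) ℂ) j i ≠ 0 := by
    apply ne_zero_of_eval_ne_zero (x := fun k => if k ∈ Finset.univ then 1 else 0)
    rw [map_nodalMatrix_X, nodalMatrix_indicator_ne_zero_iff,
      Finset.card_erase_of_mem (Finset.mem_univ j), Finset.card_univ, Fintype.card_fin]
    omega
  obtain ⟨x, hx, hPx⟩ := exists_injective_eval_ne_zero hP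
  obtain ⟨c, hc, hadj⟩ := adjugate_transpose_vandermonde hx
  apply ne_zero_of_eval_ne_zero (x := x)
  rw [eval_pullback, evalAt_adjugate, hadj, ← map_nodalMatrix_X]
  exact mul_ne_zero (hc j) hPx

theorem pullback_cycleForm_ne_zero {n : ℕ} {i j : Fin 3 → Fin n}
    (hi : Function.Injective i) (hj : Function.Injective j) :
    pullback n (cycleForm (mvPolynomialX (Fin n) (Fin n) ℂ).adjugate i j) ≠ 0 := by
  have heval : ∀ x : Fin n → ℂ, MvPolynomial.eval x (cycleForm (nodalMatrix
      (MvPolynomial.X : Fin n → MvPolynomial (Fin n) ℂ)) i j) = cycleForm (nodalMatrix x) i j := by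
    intro x
    simp only [cycleForm, map_sub, map_mul, map_nodalMatrix_X]
  obtain ⟨x₀, hx₀⟩ := exists_cycleForm_nodalMatrix_ne_zero hi hj
  rw [← heval] at hx₀
  obtain ⟨x, hx, hPx⟩ := exists_injective_eval_ne_zero (ne_zero_of_eval_ne_zero hx₀)
  rw [heval] at hPx
  obtain ⟨c, hc, hadj⟩ := adjugate_transpose_vandermonde hx
  apply ne_zero_of_eval_ne_zero (x := x)
  rw [eval_pullback, evalAt_cycleForm]
  -- Each of the two products uses every row `j s` exactly once, so the row scalars factor out.
  have : cycleForm (vandermonde x)ᵀ.adjugate i j =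
      c (j 0) * c (j 1) * c (j 2) * cycleForm (nodalMatrix x) i j := by
    simp only [cycleForm, hadj]
    ring
  rw [this]
  exact mul_ne_zero (mul_ne_zero (mul_ne_zero (hc _) (hc _)) (hc _)) hPx

theorem exists_pullback_ne_zero_sub_two {n : ℕ} (hn : 2 ≤ n) :
    ∃ Q : MvPolynomial (Fin n × Fin n) ℂ, pullback n Q ≠ 0 ∧
      ∀ M ∈ rigiditySet n (n - 2) 3, evalAt M Q = 0 := by
  classical
  let C := (mvPolynomialX (Fin n) (Fin n) ℂ).adjugate
  let Inj := {i : Fin 3 → Fin n // Function.Injective i}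
  refine ⟨(∏ j, ∏ i, C j i) * ∏ i : Inj, ∏ j : Inj, cycleForm C i.1 j.1, ?_, ?_⟩
  · simp only [map_mul, map_prod]
    refine mul_ne_zero ?_ ?_
    · exact Finset.prod_ne_zero_iff.mpr fun j _ => Finset.prod_ne_zero_iff.mpr fun i _ =>
        pullback_adjugate_ne_zero i j
    · exact Finset.prod_ne_zero_iff.mpr fun i _ => Finset.prod_ne_zero_iff.mpr fun j _ =>
        pullback_cycleForm_ne_zero i.2 j.2
  · intro M hM
    rw [evalAt, map_mul, mul_eq_zero, map_prod, map_prod]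
    simp_rw [map_prod]
    refine (exists_adjugate_or_cycleForm_eq_zero hn hM).imp ?_ ?_
    · rintro ⟨j, i, h⟩
      refine Finset.prod_eq_zero (Finset.mem_univ j) (Finset.prod_eq_zero (Finset.mem_univ i) ?_)
      exact (evalAt_adjugate M j i).trans h
    · rintro ⟨i, j, hi, hj, h⟩
      refine Finset.prod_eq_zero (Finset.mem_univ ⟨i, hi⟩)
        (Finset.prod_eq_zero (Finset.mem_univ ⟨j, hj⟩) ?_)
      exact (evalAt_cycleForm M i j).trans h

end MatrixRigidity

/-! ### Assembly of the four assertions -/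

open MatrixRigidity in
theorem mainTheorem11 (n : ℕ) (hn : 2 ≤ n) :
    ¬ MatrixRigidity.vandermondeVariety n ⊆ MatrixRigidity.rigidityVariety n 1 (n ^ 2 - 2 * n) ∧
    ¬ MatrixRigidity.vandermondeVariety n ⊆ MatrixRigidity.rigidityVariety n (n - 2) 3 ∧
    MatrixRigidity.HoldsGenericallyOn (MatrixRigidity.vandermondeVariety n)
      (fun M => MatrixRigidity.IsMaximallyBorderRigid 1 M ∧
        MatrixRigidity.IsMaximallyBorderRigid (n - 2) M) ∧
    (∃ P : MvPolynomial (Fin n) ℂ, P ≠ 0 ∧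
      ∀ x : Fin n → ℂ, MvPolynomial.eval x P ≠ 0 →
        MatrixRigidity.IsMaximallyBorderRigid 1 (Matrix.vandermonde x).transpose ∧
        MatrixRigidity.IsMaximallyBorderRigid (n - 2) (Matrix.vandermonde x).transpose) := by
  obtain ⟨Q₁, hQ₁, hM₁⟩ := exists_pullback_ne_zero_one hn
  obtain ⟨Q₂, hQ₂, hM₂⟩ := exists_pullback_ne_zero_sub_two hn
  have hQ : pullback n (Q₁ * Q₂) ≠ 0 := by
    rw [map_mul]
    exact mul_ne_zero hQ₁ hQ₂
  have hs₁ : (n - 1) ^ 2 - 1 = n ^ 2 - 2 * n := by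
    obtain ⟨m, rfl⟩ := Nat.exists_eq_add_of_le hn
    have : (2 + m) ^ 2 = (2 + m - 1) ^ 2 - 1 + 2 * (2 + m) := by
      rw [show 2 + m - 1 = m + 1 by omega, show (m + 1) ^ 2 = m * (m + 2) + 1 by ring,
        Nat.add_sub_cancel]
      ring
    omega
  have hs₂ : (n - (n - 2)) ^ 2 - 1 = 3 := by
    rw [show n - (n - 2) = 2 by omega]
    rfl
  have hnot : ∀ M : Matrix (Fin n) (Fin n) ℂ, evalAt M (Q₁ * Q₂) ≠ 0 →
      M ∉ rigidityVariety n 1 (n ^ 2 - 2 * n) ∧ M ∉ rigidityVariety n (n - 2) 3 := by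
    intro M hM
    rw [evalAt, map_mul] at hM
    exact ⟨notMem_rigidityVariety hM₁ (left_ne_zero_of_mul hM),
      notMem_rigidityVariety hM₂ (right_ne_zero_of_mul hM)⟩
  have hrigid : ∀ M : Matrix (Fin n) (Fin n) ℂ, evalAt M (Q₁ * Q₂) ≠ 0 →
      IsMaximallyBorderRigid 1 M ∧ IsMaximallyBorderRigid (n - 2) M := by
    intro M hM
    rw [IsMaximallyBorderRigid, IsMaximallyBorderRigid, hs₁, hs₂]
    exact hnot M hM
  obtain ⟨x, hx⟩ := exists_eval_ne_zero hQ
  rw [eval_pullback] at hx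
  refine ⟨fun h => (hnot _ hx).1 (h (transpose_vandermonde_mem x)),
    fun h => (hnot _ hx).2 (h (transpose_vandermonde_mem x)),
    ⟨{Q₁ * Q₂}, ?_, ?_⟩, pullback n (Q₁ * Q₂), hQ, fun x hx => hrigid _ ?_⟩
  · simpa using vandermondeVariety_subset_zariskiClosure hQ
  · rintro M - ⟨Q, rfl, hM⟩
    exact hrigid M hM
  · rwa [← eval_pullback]
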